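/- Let $S$ be a nonempty set, $\Sigma$ an algebra of subsets of $S$, and $X$ a nonempty convex subset of a real vector space. Let $\mathcal F$ be the set of simple acts (finitely valued $\Sigma$-measurable maps $f:S\to X$), mixed state by state; consequences $x\in X$ are identified with constant acts. Let $\Delta$ be the set of finitely additive probabilities on $\Sigma$ with the weak* topology $\sigma(\Delta,B_0(\Sigma))$, where $B_0(\Sigma)$ is the set of finitely valued $\Sigma$-measurable real functions. Let $\succsim$ be a binary relation on $\mathcal F$ with symmetric part $\sim$ and asymmetric part $\succ$. It is an invariant biseparable (IB) preference if it satisfies * (Weak Order) $\succsim$ is nontrivial ($f\succ g$ for some $f,g$), complete and transitive; * (Monotonicity) if $f(s)\succsim g(s)$ for all $s\in S$, then $f\succsim g$; * (Archimedean) if $f\succ g\succ h$, then there are $\alpha,\beta\in(0,1)$ with $\alpha f+(1-\alpha)h\succ g\succ\beta f+(1-\beta)h$; * (C-Independence) for all $f,g\in\mathcal F$, $x\in X$, $\alpha\in(0,1)$: $f\succsim g\Leftrightarrow\alpha f+(1-\alpha)x\succsim\alpha g+(1-\alpha)x$. **Theorem.** The following are equivalent: (i) $\succsim$ is an IB preference;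 (ii) there are a nonconstant affine $u:X\to\mathbb R$ and a family $\mathscr P$ of nonempty convex compact subsets of $\Delta$ such that, for all $f,g\in\mathcal F$, $$f\succsim g\iff\max_{P\in\mathscr P}\min_{p\in P}\int u(f)\,dp\ \ge\ \max_{P\in\mathscr P}\min_{p\in P}\int u(g)\,dp ;\tag{1}$$ (iii) there are a nonconstant affine $u:X\to\mathbb R$ and a family $\mathscr Q$ of nonempty convex compact subsets of $\Delta$ such that, for all $f,g\in\mathcal F$, $$f\succsim g\iff\min_{Q\in\mathscr Q}\max_{q\in Q}\int u(f)\,dq\ \ge\ \min_{Q\in\mathscr Q}\max_{q\in Q}\int u(g)\,dq .\tag{2}$$ In (1) and (2) all maxima and minima are attained. If $\succsim$ is an IB preference, every act $f$ has a certainty equivalent, that is, some $x_f\in X$ with $x_f\sim f$. The function $u$ is cardinally unique: if $u$ is a nonconstant affine function that occurs in a representation (ii) or (iii), then the functions occurring in such representations are exactly $au+b$ with $a>0$, $b\in\mathbb R$. For each such $u$, among the families of nonempty convex compact subsets of $\Delta$ satisfying (1) there is a greatest one with respect to inclusion, $$\mathscr P^*=\Big\{P\subseteq\Delta\ \Big|\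 P\text{ nonempty, convex, compact},\ \min_{p\in P}\int u(f)\,dp\le u(x_f)\ \text{for all }f\in\mathcal F\Big\},$$ and among those satisfying (2) there is a greatest one, $$\mathscr Q^*=\Big\{Q\subseteq\Delta\ \Big|\ Q\text{ nonempty, convex, compact},\ \max_{q\in Q}\int u(f)\,dq\ge u(x_f)\ \text{for all }f\in\mathcal F\Big\}.$$ -/

import Mathlib

/-- Simple maps: finitely valued maps `S → Y` that are measurable with respect to the algebra of
events `𝒜`. For finitely many values, measurability means that every level set is an event. With
`Y` a set of consequences these are the simple acts, and with `Y = ℝ` they form `B₀(𝒜)`. -/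
structure SimpleMap {S : Type*} (𝒜 : BooleanSubalgebra (Set S)) (Y : Type*) where
  toFun : S → Y
  finite_range : (Set.range toFun).Finite
  measurable : ∀ y : Y, toFun ⁻¹' {y} ∈ 𝒜

namespace SimpleMap

variable {S : Type*} {𝒜 : BooleanSubalgebra (Set S)} {Y Z : Type*}

instance : CoeFun (SimpleMap 𝒜 Y) (fun _ => S → Y) := ⟨SimpleMap.toFun⟩

/-- The preimage of any set under a simple map is an event. -/
theorem preimage_mem (f : SimpleMap 𝒜 Y) (T : Set Y) : f.toFun ⁻¹' T ∈ 𝒜 := by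
  have key : ∀ F : Set Y, F.Finite → f.toFun ⁻¹' F ∈ 𝒜 := by
    intro F hF
    induction F, hF using Set.Finite.induction_on with
    | empty => simpa using 𝒜.bot_mem
    | insert _ _ ih =>
      rw [Set.insert_eq, Set.preimage_union]
      exact 𝒜.supClosed (f.measurable _) ih
  have h := key (T ∩ Set.range f.toFun) (f.finite_range.subset Set.inter_subset_right)
  rwa [Set.preimage_inter_range] at h

/-- The simple map `s ↦ g (f s)`; with `g` a utility function `u`, this is `u(f)`. -/
def map (g : Y → Z) (f : SimpleMap 𝒜 Y) : SimpleMap 𝒜 Z where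
  toFun := fun s => g (f s)
  finite_range := by
    have h := f.finite_range.image g
    rwa [← Set.range_comp] at h
  measurable := fun z => f.preimage_mem (g ⁻¹' {z})

/-- The simple map `s ↦ (f s, g s)`. -/
def pair (f : SimpleMap 𝒜 Y) (g : SimpleMap 𝒜 Z) : SimpleMap 𝒜 (Y × Z) where
  toFun := fun s => (f s, g s)
  finite_range := (f.finite_range.prod g.finite_range).subset (by
    rintro _ ⟨s, rfl⟩
    exact ⟨⟨s, rfl⟩, ⟨s, rfl⟩⟩)
  measurable := by
    rintro ⟨y, z⟩
    have h : (fun s => (f s, g s)) ⁻¹' {(y, z)} = f.toFun ⁻¹' {y} ∩ g.toFun ⁻¹' {z} := by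
      ext s
      simp [Prod.ext_iff]
    rw [h]
    exact 𝒜.infClosed (f.measurable y) (g.measurable z)

/-- The constant simple map. -/
def const (𝒜 : BooleanSubalgebra (Set S)) (y : Y) : SimpleMap 𝒜 Y where
  toFun := fun _ => y
  finite_range := (Set.finite_singleton y).subset (by rintro _ ⟨_, rfl⟩; rfl)
  measurable := by
    classical
    intro z
    rw [Set.preimage_const]
    split_ifs
    · exact 𝒜.top_mem
    · exact 𝒜.bot_mem

end SimpleMap

/-- Finitely additive probabilities on the algebra of events `𝒜`; this is the set `Δ`. -/
structure FinAddProb {S : Type*} (𝒜 : BooleanSubalgebra (Set S)) where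
  toFun : 𝒜 → ℝ
  nonneg : ∀ A : 𝒜, 0 ≤ toFun A
  univ_eq_one : toFun ⊤ = 1
  additive : ∀ A B : 𝒜, Disjoint (A : Set S) (B : Set S) → toFun (A ⊔ B) = toFun A + toFun B

namespace FinAddProb

variable {S : Type*} {𝒜 : BooleanSubalgebra (Set S)}

/-- The integral `∫ φ dp` of a real-valued simple map. -/
noncomputable def integral (p : FinAddProb 𝒜) (φ : SimpleMap 𝒜 ℝ) : ℝ :=
  ∑ t ∈ φ.finite_range.toFinset, t * p.toFun ⟨φ.toFun ⁻¹' {t}, φ.measurable t⟩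

/-- The weak* topology `σ(Δ, B₀(𝒜))`: the coarsest one for which all maps `p ↦ ∫ φ dp`, with `φ`
in `B₀(𝒜)`, are continuous. -/
noncomputable instance weakStarTopology : TopologicalSpace (FinAddProb 𝒜) :=
  TopologicalSpace.induced (fun p (φ : SimpleMap 𝒜 ℝ) => p.integral φ) inferInstance

/-- Nonempty convex and weak* compact sets of priors (convex as sets of set functions). -/
def IsPriorSet (P : Set (FinAddProb 𝒜)) : Prop :=
  P.Nonempty ∧ Convex ℝ (FinAddProb.toFun '' P) ∧ IsCompact P

/-- `m = min_{p ∈ P} ∫ φ dp`, the minimum being attained. -/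
def IsMin (P : Set (FinAddProb 𝒜)) (φ : SimpleMap 𝒜 ℝ) (m : ℝ) : Prop :=
  IsLeast ((fun p => p.integral φ) '' P) m

/-- `m = max_{p ∈ P} ∫ φ dp`, the maximum being attained. -/
def IsMax (P : Set (FinAddProb 𝒜)) (φ : SimpleMap 𝒜 ℝ) (m : ℝ) : Prop :=
  IsGreatest ((fun p => p.integral φ) '' P) m

/-- `v = max_{P ∈ Ps} min_{p ∈ P} ∫ φ dp`, the maximum and the minima being attained. -/
def IsMaxMin (Ps : Set (Set (FinAddProb 𝒜))) (φ : SimpleMap 𝒜 ℝ) (v : ℝ) : Prop :=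
  IsGreatest {m | ∃ P ∈ Ps, IsMin P φ m} v

/-- `v = min_{Q ∈ Qs} max_{q ∈ Q} ∫ φ dq`, the minimum and the maxima being attained. -/
def IsMinMax (Qs : Set (Set (FinAddProb 𝒜))) (φ : SimpleMap 𝒜 ℝ) (v : ℝ) : Prop :=
  IsLeast {m | ∃ Q ∈ Qs, IsMax Q φ m} v

end FinAddProb

/-- Simple acts: simple maps with values in the set of consequences `X`. -/
abbrev Act {S : Type*} (𝒜 : BooleanSubalgebra (Set S)) {E : Type*} (X : Set E) :=
  SimpleMap 𝒜 X

section Preferences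

variable {S : Type*} {𝒜 : BooleanSubalgebra (Set S)}
  {E : Type*} [AddCommGroup E] [Module ℝ E] {X : Set E}

/-- The consequence `α x + (1 - α) y`. -/
def mixPoint (hX : Convex ℝ X) (α : unitInterval) (x y : X) : X :=
  ⟨(α : ℝ) • (x : E) + (1 - (α : ℝ)) • (y : E),
    hX x.2 y.2 α.2.1 (sub_nonneg.2 α.2.2) (add_sub_cancel _ _)⟩

/-- The mixed act `α f + (1 - α) g`, formed state by state. -/
def mixAct (hX : Convex ℝ X) (α : unitInterval) (f g : Act 𝒜 X) : Act 𝒜 X :=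
  (f.pair g).map (fun xy => mixPoint hX α xy.1 xy.2)

/-- The asymmetric part of a relation. -/
def Strictly (R : Act 𝒜 X → Act 𝒜 X → Prop) (f g : Act 𝒜 X) : Prop :=
  R f g ∧ ¬ R g f

/-- The symmetric part of a relation. -/
def Indifferent (R : Act 𝒜 X → Act 𝒜 X → Prop) (f g : Act 𝒜 X) : Prop :=
  R f g ∧ R g f

/-- Weak Order: nontrivial, complete and transitive. -/
def WeakOrder (R : Act 𝒜 X → Act 𝒜 X → Prop) : Prop :=
  (∃ f g, Strictly R f g) ∧ (∀ f g, R f g ∨ R g f) ∧ (∀ f g h, R f g → R g h → R f h)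

/-- Monotonicity. -/
def MonotoneAxiom (R : Act 𝒜 X → Act 𝒜 X → Prop) : Prop :=
  ∀ f g : Act 𝒜 X,
    (∀ s, R (SimpleMap.const 𝒜 (f s)) (SimpleMap.const 𝒜 (g s))) → R f g

/-- The Archimedean axiom. -/
def ArchimedeanAxiom (hX : Convex ℝ X) (R : Act 𝒜 X → Act 𝒜 X → Prop) : Prop :=
  ∀ f g h : Act 𝒜 X, Strictly R f g → Strictly R g h →
    ∃ α ∈ Set.Ioo (0 : unitInterval) 1, ∃ β ∈ Set.Ioo (0 : unitInterval) 1,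
      Strictly R (mixAct hX α f h) g ∧ Strictly R g (mixAct hX β f h)

/-- C-Independence. -/
def CIndependence (hX : Convex ℝ X) (R : Act 𝒜 X → Act 𝒜 X → Prop) : Prop :=
  ∀ (f g : Act 𝒜 X) (x : X), ∀ α ∈ Set.Ioo (0 : unitInterval) 1,
    (R f g ↔
      R (mixAct hX α f (SimpleMap.const 𝒜 x)) (mixAct hX α g (SimpleMap.const 𝒜 x)))

/-- Invariant biseparable preferences. -/
def InvariantBiseparable (hX : Convex ℝ X) (R : Act 𝒜 X → Act 𝒜 X → Prop) : Prop :=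
  WeakOrder R ∧ MonotoneAxiom R ∧ ArchimedeanAxiom hX R ∧ CIndependence hX R

/-- Nonconstant affine functions `u : X → ℝ`. -/
def NonconstantAffine (hX : Convex ℝ X) (u : X → ℝ) : Prop :=
  (∃ x y, u x ≠ u y) ∧
    ∀ (α : unitInterval) (x y : X), u (mixPoint hX α x y) = α * u x + (1 - α) * u y

/-- `Ps` is a family of prior sets such that all `V f = max_{P ∈ Ps} min_{p ∈ P} ∫ u(f) dp` exist
and `V` represents `R`. -/
def MaxMinRep (R : Act 𝒜 X → Act 𝒜 X → Prop) (u : X → ℝ)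
    (Ps : Set (Set (FinAddProb 𝒜))) : Prop :=
  (∀ P ∈ Ps, FinAddProb.IsPriorSet P) ∧
    ∃ V : Act 𝒜 X → ℝ, (∀ f, FinAddProb.IsMaxMin Ps (f.map u) (V f)) ∧
      ∀ f g, R f g ↔ V f ≥ V g

/-- `Qs` is a family of prior sets such that all `V f = min_{Q ∈ Qs} max_{q ∈ Q} ∫ u(f) dq` exist
and `V` represents `R`. -/
def MinMaxRep (R : Act 𝒜 X → Act 𝒜 X → Prop) (u : X → ℝ)
    (Qs : Set (Set (FinAddProb 𝒜))) : Prop :=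
  (∀ Q ∈ Qs, FinAddProb.IsPriorSet Q) ∧
    ∃ V : Act 𝒜 X → ℝ, (∀ f, FinAddProb.IsMinMax Qs (f.map u) (V f)) ∧
      ∀ f g, R f g ↔ V f ≥ V g

/-- `x` is a certainty equivalent of the act `f`. -/
def CertaintyEquivalent (R : Act 𝒜 X → Act 𝒜 X → Prop) (f : Act 𝒜 X) (x : X) : Prop :=
  Indifferent R (SimpleMap.const 𝒜 x) f

/-- The prior sets `P` with `min_{p ∈ P} ∫ u(f) dp ≤ u(x_f)` for all acts `f`, where `x_f` is a
certainty equivalent of `f`. -/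
def maximalMaxMinFamily (R : Act 𝒜 X → Act 𝒜 X → Prop) (u : X → ℝ) :
    Set (Set (FinAddProb 𝒜)) :=
  {P | FinAddProb.IsPriorSet P ∧
    ∀ f x, CertaintyEquivalent R f x → ∃ m, FinAddProb.IsMin P (f.map u) m ∧ m ≤ u x}

/-- The prior sets `Q` with `max_{q ∈ Q} ∫ u(f) dq ≥ u(x_f)` for all acts `f`, where `x_f` is a
certainty equivalent of `f`. -/
def maximalMinMaxFamily (R : Act 𝒜 X → Act 𝒜 X → Prop) (u : X → ℝ) :
    Set (Set (FinAddProb 𝒜)) :=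
  {Q | FinAddProb.IsPriorSet Q ∧
    ∀ f x, CertaintyEquivalent R f x → ∃ m, FinAddProb.IsMax Q (f.map u) m ∧ m ≥ u x}

/-- `u` is a utility function in a representation of `R` of one of the two kinds. -/
def IsUtilityIndex (hX : Convex ℝ X) (R : Act 𝒜 X → Act 𝒜 X → Prop) (u : X → ℝ) : Prop :=
  NonconstantAffine hX u ∧ ((∃ Ps, MaxMinRep R u Ps) ∨ (∃ Qs, MinMaxRep R u Qs))

end Preferences

/-!
The axioms and both representations are compared through one intermediate notion, `Represents`: a
functional `V` on acts that represents the preference, agrees with an affine utility `u` on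
constant acts, is affine under mixing with constants, and satisfies `V f + c ≤ V g` whenever
`u(f) + c ≤ u(g)` state by state.

From the axioms to `V`: on constant acts the axioms are those of von Neumann and Morgenstern. The
directions of weak improvement form a cone that is total and Archimedean on the span of the
differences of consequences, hence a half-space of a linear functional, which gives `u`
(`exists_affine_utility`). The Archimedean axiom yields certainty equivalents, `V f` is the utility
of one of them, and C-Independence turns into the properties of `V` because the constant `c` can be
taken to be a utility difference (`InvariantBiseparable.exists_represents`). The converse
(`Represents.invariantBiseparable`) is direct.

From `V` to priors: for any two acts `f` and `g` there is a finitely additive probability `p` with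
`V f ≤ ∫ u(f) dp` and `∫ u(g) dp ≤ V g` (`Represents.exists_prob`). The pairs of integrals form a
compact convex set in the plane; were it disjoint from the quadrant in question, a separating line
would give weights `a, b ≥ 0` with `a (u(f) - V f) + δ ≤ b (u(g) - V g)` in all states for some
`δ > 0`, and mixing the act with the smaller weight with its certainty equivalent contradicts the
last property of `V`. Therefore the half-space of priors `{p | V f ≤ ∫ u(f) dp}` belongs to the
maximal family and attains the value `V f` at `f`. It is a prior set because the finitely additive
probabilities are weak* compact (`FinAddProb.isCompact_univ`).

Min-max representations are max-min representations of the reversed preference with utility `-u`.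
-/

/-! ### Integration of simple maps -/

namespace FinAddProb

variable {S : Type*} {𝒜 : BooleanSubalgebra (Set S)} {Y : Type*}

theorem toFun_bot (p : FinAddProb 𝒜) : p.toFun ⊥ = 0 := by
  have h := p.additive ⊥ ⊥ (by simp)
  rw [sup_idem] at h
  linarith

theorem toFun_preimage (p : FinAddProb 𝒜) (f : SimpleMap 𝒜 Y) (F : Finset Y) :
    p.toFun ⟨f.toFun ⁻¹' (F : Set Y), f.preimage_mem _⟩ =
      ∑ y ∈ F, p.toFun ⟨f.toFun ⁻¹' {y}, f.measurable y⟩ := by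
  classical
  induction F using Finset.induction_on with
  | empty =>
    rw [Finset.sum_empty, ← p.toFun_bot]
    congr 1
    ext1
    simp
  | insert y F hy ih =>
    rw [Finset.sum_insert hy, ← ih, ← p.additive]
    · congr 1
      ext1
      change _ = f.toFun ⁻¹' {y} ∪ f.toFun ⁻¹' (F : Set Y)
      rw [← Set.preimage_union, Finset.coe_insert, Set.insert_eq]
    · exact Disjoint.preimage _ (by simpa using hy)

/-- Change of variables: the integral of `k ∘ f` is a sum over the values of `f`. -/
theorem integral_map (p : FinAddProb 𝒜) (f : SimpleMap 𝒜 Y) (k : Y → ℝ) :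
    p.integral (f.map k) =
      ∑ y ∈ f.finite_range.toFinset, k y * p.toFun ⟨f.toFun ⁻¹' {y}, f.measurable y⟩ := by
  classical
  have hmaps : ∀ y ∈ f.finite_range.toFinset, k y ∈ (f.map k).finite_range.toFinset := by
    simp only [Set.Finite.mem_toFinset]
    rintro _ ⟨s, rfl⟩
    exact ⟨s, rfl⟩
  rw [integral, ← Finset.sum_fiberwise_of_maps_to hmaps]
  refine Finset.sum_congr rfl fun t _ => ?_
  rw [Finset.sum_congr rfl (g := fun y => t * p.toFun ⟨f.toFun ⁻¹' {y}, f.measurable y⟩),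
    ← Finset.mul_sum, ← p.toFun_preimage]
  · congr 2
    ext1
    ext s
    simp [SimpleMap.map]
  · intro y hy
    rw [(Finset.mem_filter.1 hy).2]

theorem integral_map_linear (p : FinAddProb 𝒜) (f : SimpleMap 𝒜 Y) (a b : ℝ) (k l : Y → ℝ) :
    p.integral (f.map fun y => a * k y + b * l y) =
      a * p.integral (f.map k) + b * p.integral (f.map l) := by
  simp only [integral_map, Finset.mul_sum, ← Finset.sum_add_distrib]
  exact Finset.sum_congr rfl fun y _ => by ring

theorem integral_map_const (p : FinAddProb 𝒜) (f : SimpleMap 𝒜 Y) (c : ℝ) :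
    p.integral (f.map fun _ => c) = c := by
  rw [integral_map, ← Finset.mul_sum, ← p.toFun_preimage]
  suffices h : (⟨_, f.preimage_mem f.finite_range.toFinset⟩ : 𝒜) = ⊤ by
    rw [h, p.univ_eq_one, mul_one]
  ext1
  ext s
  simp

theorem integral_map_neg (p : FinAddProb 𝒜) (f : SimpleMap 𝒜 Y) (k : Y → ℝ) :
    p.integral (f.map fun y => -k y) = -p.integral (f.map k) := by
  simp only [integral_map, neg_mul, Finset.sum_neg_distrib]

theorem integral_map_mono (p : FinAddProb 𝒜) (f : SimpleMap 𝒜 Y) {k l : Y → ℝ}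
    (h : ∀ s, k (f s) ≤ l (f s)) : p.integral (f.map k) ≤ p.integral (f.map l) := by
  rw [integral_map, integral_map]
  refine Finset.sum_le_sum fun y hy => ?_
  obtain ⟨s, rfl⟩ := f.finite_range.mem_toFinset.1 hy
  exact mul_le_mul_of_nonneg_right (h s) (p.nonneg _)

/-- Monotonicity of the integral up to a constant. -/
theorem integral_add_const_le (p : FinAddProb 𝒜) (f g : SimpleMap 𝒜 Y) (k : Y → ℝ) (c : ℝ)
    (h : ∀ s, k (f s) + c ≤ k (g s)) :
    p.integral (f.map k) + c ≤ p.integral (g.map k) := by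
  have h1 := p.integral_map_mono (f.pair g) (k := fun y => 1 * k y.1 + 1 * c)
    (l := fun y => k y.2) (fun s => by simpa [SimpleMap.pair] using h s)
  rw [p.integral_map_linear (f.pair g) 1 1 (fun y => k y.1) (fun _ => c), integral_map_const,
    one_mul, one_mul] at h1
  exact h1

/-- The point mass at a state. -/
noncomputable def dirac (𝒜 : BooleanSubalgebra (Set S)) (s : S) : FinAddProb 𝒜 where
  toFun := fun A => Set.indicator (A : Set S) 1 s
  nonneg := fun A => Set.indicator_nonneg (fun _ _ => zero_le_one) s
  univ_eq_one := by simp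
  additive := fun A B h => by
    change Set.indicator ((A : Set S) ∪ B) 1 s = _
    rw [Set.indicator_union_of_disjoint h]

theorem integral_dirac (s : S) (f : SimpleMap 𝒜 Y) (k : Y → ℝ) :
    (dirac 𝒜 s).integral (f.map k) = k (f s) := by
  rw [integral_map, Finset.sum_eq_single (f s)]
  · simp [dirac]
  · intro y _ hy
    have : f s ≠ y := fun h => hy h.symm
    simp [dirac, this]
  · intro h
    exact absurd (f.finite_range.mem_toFinset.2 ⟨s, rfl⟩) h

/-- The mixture `a p + b q` of two finitely additive probabilities. -/
def mix (a b : ℝ) (ha : 0 ≤ a) (hb : 0 ≤ b) (hab : a + b = 1) (p q : FinAddProb 𝒜) :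
    FinAddProb 𝒜 where
  toFun := a • p.toFun + b • q.toFun
  nonneg := fun A => add_nonneg (mul_nonneg ha (p.nonneg A)) (mul_nonneg hb (q.nonneg A))
  univ_eq_one := by simp [p.univ_eq_one, q.univ_eq_one, hab]
  additive := fun A B h => by
    simp only [Pi.add_apply, Pi.smul_apply, smul_eq_mul, p.additive A B h, q.additive A B h]
    ring

theorem integral_mix (a b : ℝ) (ha : 0 ≤ a) (hb : 0 ≤ b) (hab : a + b = 1) (p q : FinAddProb 𝒜)
    (φ : SimpleMap 𝒜 ℝ) :
    (mix a b ha hb hab p q).integral φ = a * p.integral φ + b * q.integral φ := by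
  simp only [integral, mix, Finset.mul_sum, ← Finset.sum_add_distrib]
  exact Finset.sum_congr rfl fun t _ => by
    simp only [Pi.add_apply, Pi.smul_apply, smul_eq_mul]
    ring

/-! ### Weak* compactness of the set of finitely additive probabilities -/

theorem continuous_integral (φ : SimpleMap 𝒜 ℝ) :
    Continuous fun p : FinAddProb 𝒜 => p.integral φ :=
  (continuous_apply φ).comp (f := fun (p : FinAddProb 𝒜) (φ : SimpleMap 𝒜 ℝ) => p.integral φ)
    continuous_induced_dom

open Classical in
/-- The indicator function of an event. -/
noncomputable def indicatorMap (A : 𝒜) : SimpleMap 𝒜 ℝ where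
  toFun := Set.indicator (A : Set S) 1
  finite_range := (Set.toFinite {0, 1}).subset (by
    rintro _ ⟨s, rfl⟩
    by_cases h : s ∈ (A : Set S) <;> simp [h])
  measurable := fun y => by
    rw [show Set.indicator (A : Set S) (1 : S → ℝ) = Set.indicator (A : Set S) (fun _ => 1)
      from rfl, Set.indicator_const_preimage_eq_union]
    refine 𝒜.supClosed ?_ ?_
    · split_ifs
      · exact A.2
      · exact 𝒜.bot_mem
    · split_ifs
      · exact 𝒜.compl_mem A.2
      · exact 𝒜.bot_mem

theorem integral_indicatorMap (p : FinAddProb 𝒜) (A : 𝒜) :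
    p.integral (indicatorMap A) = p.toFun A := by
  have hsub : (indicatorMap A).finite_range.toFinset ⊆ {0, 1} := by
    intro t ht
    obtain ⟨s, rfl⟩ := (indicatorMap A).finite_range.mem_toFinset.1 ht
    by_cases h : s ∈ (A : Set S) <;> simp [indicatorMap, h]
  have hA : (indicatorMap A).toFun ⁻¹' {1} = (A : Set S) := by
    ext s
    by_cases h : s ∈ (A : Set S) <;> simp [indicatorMap, h]
  rw [integral, Finset.sum_subset hsub]
  · rw [Finset.sum_pair zero_ne_one, zero_mul, zero_add, one_mul]
    congr 1
    ext1
    exact hA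
  · intro t _ ht
    have : (⟨(indicatorMap A).toFun ⁻¹' {t}, (indicatorMap A).measurable t⟩ : 𝒜) = ⊥ := by
      ext1
      change (indicatorMap A).toFun ⁻¹' {t} = ∅
      refine Set.eq_empty_of_forall_notMem fun s hs => ht ?_
      exact (indicatorMap A).finite_range.mem_toFinset.2 ⟨s, hs⟩
    rw [this, toFun_bot, mul_zero]

/-- Banach–Alaoglu for finitely additive probabilities: as functionals on simple maps they form a
closed subset of a product of compact intervals. -/
theorem isCompact_univ : IsCompact (Set.univ : Set (FinAddProb 𝒜)) := by
  have hind : Topology.IsInducing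
      (fun (p : FinAddProb 𝒜) (φ : SimpleMap 𝒜 ℝ) => p.integral φ) := ⟨rfl⟩
  rw [hind.isCompact_iff, Set.image_univ]
  have hbd : ∀ φ : SimpleMap 𝒜 ℝ, ∃ M : ℝ, ∀ s, |φ s| ≤ M := fun φ => by
    obtain ⟨M, hM⟩ := (φ.finite_range.image abs).bddAbove
    exact ⟨M, fun s => hM ⟨_, ⟨s, rfl⟩, rfl⟩⟩
  choose M hM using hbd
  refine IsCompact.of_isClosed_subset
    (isCompact_univ_pi fun φ => isCompact_Icc (a := -M φ) (b := M φ)) ?_ ?_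
  · -- A functional is an integral iff it satisfies the following closed conditions.
    have hrange : Set.range (fun (p : FinAddProb 𝒜) (φ : SimpleMap 𝒜 ℝ) => p.integral φ) =
        {L | (∀ A, 0 ≤ L (indicatorMap A)) ∧ L (indicatorMap ⊤) = 1 ∧
          (∀ A B : 𝒜, Disjoint (A : Set S) (B : Set S) →
            L (indicatorMap (A ⊔ B)) = L (indicatorMap A) + L (indicatorMap B)) ∧
          ∀ φ : SimpleMap 𝒜 ℝ, L φ = ∑ t ∈ φ.finite_range.toFinset,
            t * L (indicatorMap ⟨φ.toFun ⁻¹' {t}, φ.measurable t⟩)} := by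
      ext L
      constructor
      · rintro ⟨p, rfl⟩
        simp only [Set.mem_ofPred_eq, integral_indicatorMap]
        exact ⟨p.nonneg, p.univ_eq_one, p.additive, fun _ => rfl⟩
      · rintro ⟨h0, h1, hadd, hL⟩
        exact ⟨⟨fun A => L (indicatorMap A), h0, h1, hadd⟩, funext fun φ => (hL φ).symm⟩
    rw [hrange]
    simp only [Set.ofPred_and, Set.ofPred_forall]
    refine (isClosed_iInter fun A => ?_).inter (IsClosed.inter ?_ (IsClosed.inter
      (isClosed_iInter fun A => isClosed_iInter fun B => isClosed_iInter fun _ => ?_)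
      (isClosed_iInter fun φ => ?_)))
    · exact isClosed_le continuous_const (continuous_apply _)
    · exact isClosed_eq (continuous_apply _) continuous_const
    · exact isClosed_eq (continuous_apply _)
        ((continuous_apply (indicatorMap A)).add (continuous_apply (indicatorMap B)))
    · exact isClosed_eq (continuous_apply _)
        (continuous_finsetSum _ fun t _ => continuous_const.mul (continuous_apply _))
  · rintro _ ⟨p, rfl⟩ φ -
    have h1 := p.integral_map_mono φ (k := id) (l := fun _ => M φ)
      fun s => (abs_le.1 (hM φ s)).2
    have h2 := p.integral_map_mono φ (k := fun _ => -M φ) (l := id)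
      fun s => (abs_le.1 (hM φ s)).1
    rw [integral_map_const] at h1 h2
    exact ⟨h2, h1⟩

/-! ### Prior sets -/

theorem IsPriorSet.exists_isMin {P : Set (FinAddProb 𝒜)} (hP : IsPriorSet P)
    (φ : SimpleMap 𝒜 ℝ) : ∃ m, IsMin P φ m :=
  (hP.2.2.image (continuous_integral φ)).exists_isLeast (hP.1.image _)

theorem isPriorSet_le_integral (φ : SimpleMap 𝒜 ℝ) (c : ℝ)
    (h : ∃ p : FinAddProb 𝒜, c ≤ p.integral φ) :
    IsPriorSet {p : FinAddProb 𝒜 | c ≤ p.integral φ} := by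
  refine ⟨h, ?_, isCompact_univ.of_isClosed_subset
    (isClosed_le continuous_const (continuous_integral φ)) (Set.subset_univ _)⟩
  rintro _ ⟨p, hp, rfl⟩ _ ⟨q, hq, rfl⟩ a b ha hb hab
  refine ⟨mix a b ha hb hab p q, ?_, rfl⟩
  rw [Set.mem_ofPred_eq] at hp hq
  rw [Set.mem_ofPred_eq, integral_mix]
  calc c = a * c + b * c := by rw [← add_mul, hab, one_mul]
    _ ≤ _ := add_le_add (mul_le_mul_of_nonneg_left hp ha) (mul_le_mul_of_nonneg_left hq hb)

end FinAddProb

/-! ### Affine utilities from orderings of a convex set -/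

/-- A convex cone that is total and Archimedean on a subspace `W` is, within `W`, the nonnegative
half-space of a linear functional. -/
theorem exists_linearMap_of_archimedean_cone {E : Type*} [AddCommGroup E] [Module ℝ E]
    (W : Submodule ℝ E) (C : ConvexCone ℝ E) (htot : ∀ v ∈ W, v ∈ C ∨ -v ∈ C)
    (harch : ∀ v ∈ W, -v ∉ C → ∀ w ∈ W, ∃ ε : ℝ, 0 < ε ∧ -(v + ε • w) ∉ C)
    {e : E} (heW : e ∈ W) (he : -e ∉ C) :
    ∃ l : W →ₗ[ℝ] ℝ, ∀ v : W, (v : E) ∈ C ↔ 0 ≤ l v := by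
  have hzero : (0 : E) ∈ C := by simpa using htot 0 W.zero_mem
  have heC : e ∈ C := (htot e heW).resolve_right he
  have hsmul : ∀ t : ℝ, t • e ∈ C ↔ 0 ≤ t := fun t => by
    rcases lt_trichotomy t 0 with ht | rfl | ht
    · refine iff_of_false (fun h => he ?_) ht.not_ge
      have := C.smul_mem (inv_pos.2 (neg_pos.2 ht)) h
      rwa [smul_smul, inv_neg, neg_mul, inv_mul_cancel₀ ht.ne, neg_one_smul] at this
    · simpa using hzero
    · exact iff_of_true (C.smul_mem ht heC) ht.le
  -- `l v` is the supremum of the `t` for which `v` dominates `t e`.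
  have hex : ∀ v ∈ W, ∃ t : ℝ, v - t • e ∈ C ∧ t • e - v ∈ C := by
    intro v hv
    set T : Set ℝ := {t | v - t • e ∈ C} with hT
    have hW : ∀ t : ℝ, v - t • e ∈ W := fun t => W.sub_mem hv (W.smul_mem t heW)
    have hne : T.Nonempty := by
      obtain ⟨ε, hε, h⟩ := harch e heW he v hv
      refine ⟨-ε⁻¹, ?_⟩
      have h1 := C.smul_mem (inv_pos.2 hε)
        ((htot _ (W.add_mem heW (W.smul_mem ε hv))).resolve_right h)
      rw [smul_add, smul_smul, inv_mul_cancel₀ hε.ne', one_smul] at h1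
      rwa [hT, Set.mem_ofPred_eq, neg_smul, sub_neg_eq_add, add_comm]
    have hbdd : BddAbove T := by
      obtain ⟨ε, hε, h⟩ := harch e heW he (-v) (W.neg_mem hv)
      refine ⟨ε⁻¹, fun t ht => ?_⟩
      by_contra! hlt
      refine h ?_
      have h2 := C.add_mem ht ((hsmul (t - ε⁻¹)).2 (sub_nonneg.2 hlt.le))
      have h1 := C.smul_mem hε h2
      convert h1 using 1
      rw [sub_smul, sub_add_sub_cancel, smul_sub, smul_smul, mul_inv_cancel₀ hε.ne', one_smul,
        smul_neg]
      abel
    refine ⟨sSup T, ?_, ?_⟩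
    · by_contra hC
      obtain ⟨ε, hε, h⟩ := harch (sSup T • e - v)
        (by simpa using W.neg_mem (hW (sSup T))) (by simpa using hC) (-e) (W.neg_mem heW)
      obtain ⟨t, ht, hlt⟩ := exists_lt_of_lt_csSup hne (sub_lt_self (sSup T) hε)
      refine h ?_
      have := C.add_mem ht ((hsmul (t - (sSup T - ε))).2 (sub_nonneg.2 hlt.le))
      convert this using 1
      module
    · by_contra hC
      obtain ⟨ε, hε, h⟩ := harch (v - sSup T • e) (hW _) (by simpa using hC)
        (-e) (W.neg_mem heW)
      have hmem : sSup T + ε ∈ T := by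
        have := (htot _ (W.add_mem (hW (sSup T)) (W.smul_mem ε (W.neg_mem heW)))).resolve_right h
        rw [hT, Set.mem_ofPred_eq]
        convert this using 1
        module
      linarith [le_csSup hbdd hmem]
  choose! l hl1 hl2 using hex
  have huniq : ∀ v ∈ W, ∀ t : ℝ, v - t • e ∈ C → t • e - v ∈ C → l v = t := by
    intro v hv t h1 h2
    have h3 := C.add_mem h1 (hl2 v hv)
    have h4 := C.add_mem h2 (hl1 v hv)
    rw [show v - t • e + (l v • e - v) = (l v - t) • e by module, hsmul] at h3
    rw [show t • e - v + (v - l v • e) = (t - l v) • e by module, hsmul] at h4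
    linarith
  refine ⟨⟨⟨fun v => l v, fun v w => ?_⟩, fun c v => ?_⟩, fun v => ⟨fun hv => ?_, fun hv => ?_⟩⟩
  · refine huniq _ (v + w).2 _ ?_ ?_
    · convert C.add_mem (hl1 v v.2) (hl1 w w.2) using 1
      rw [W.coe_add]
      module
    · convert C.add_mem (hl2 v v.2) (hl2 w w.2) using 1
      rw [W.coe_add]
      module
  · refine huniq _ (c • v).2 _ ?_ ?_
    all_goals
      rw [W.coe_smul]
      simp only [RingHom.id_apply, smul_eq_mul]
      rcases lt_trichotomy c 0 with hc | rfl | hc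
    · convert C.smul_mem (neg_pos.2 hc) (hl2 v v.2) using 1
      module
    · simpa using hzero
    · convert C.smul_mem hc (hl1 v v.2) using 1
      module
    · convert C.smul_mem (neg_pos.2 hc) (hl1 v v.2) using 1
      module
    · simpa using hzero
    · convert C.smul_mem hc (hl2 v v.2) using 1
      module
  · have := C.add_mem (hl2 v v.2) hv
    rwa [sub_add_cancel, hsmul] at this
  · have := C.add_mem (hl1 v v.2) ((hsmul _).2 hv)
    rwa [LinearMap.coe_mk, AddHom.coe_mk, sub_add_cancel] at this

section Utility

variable {E : Type*} [AddCommGroup E] [Module ℝ E] {X : Set E}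

theorem mixPoint_symm (hX : Convex ℝ X) (α : unitInterval) (x y : X) :
    mixPoint hX α x y = mixPoint hX (unitInterval.symm α) y x := by
  ext1
  simp only [mixPoint, unitInterval.coe_symm_eq, sub_sub_cancel]
  rw [add_comm]

theorem symm_mem_Ioo {α : unitInterval} (hα : α ∈ Set.Ioo (0 : unitInterval) 1) :
    unitInterval.symm α ∈ Set.Ioo (0 : unitInterval) 1 := by
  have h1 : (α : ℝ) < 1 := hα.2
  have h0 : 0 < (α : ℝ) := hα.1
  constructor
  · change (0 : ℝ) < 1 - α
    linarith
  · change (1 : ℝ) - α < 1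
    linarith

theorem exists_unitInterval {t : ℝ} (h0 : 0 < t) (h1 : t < 1) :
    ∃ α ∈ Set.Ioo (0 : unitInterval) 1, (α : ℝ) = t :=
  ⟨⟨t, h0.le, h1.le⟩, ⟨h0, h1⟩, rfl⟩

/-- The von Neumann–Morgenstern theorem: a complete and transitive relation on a convex set that
satisfies independence and an Archimedean axiom is represented by an affine function. The
directions of weak improvement form a total Archimedean cone in the span of the differences. -/
theorem exists_affine_utility (hX : Convex ℝ X) (r : X → X → Prop)
    (hnt : ∃ x y, ¬ r y x)
    (hcomp : ∀ x y, r x y ∨ r y x) (htrans : ∀ x y z, r x y → r y z → r x z)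
    (harch : ∀ x y z, ¬ r y x → ¬ r z y →
      ∃ α ∈ Set.Ioo (0 : unitInterval) 1, ¬ r y (mixPoint hX α x z))
    (hind : ∀ x y z, ∀ α ∈ Set.Ioo (0 : unitInterval) 1,
      (r x y ↔ r (mixPoint hX α x z) (mixPoint hX α y z))) :
    ∃ u : X → ℝ, NonconstantAffine hX u ∧ ∀ x y, r x y ↔ u y ≤ u x := by
  have hrefl : ∀ x, r x x := fun x => (hcomp x x).elim id id
  have hind' : ∀ x y z, ∀ α ∈ Set.Ioo (0 : unitInterval) 1,
      (r x y ↔ r (mixPoint hX α z x) (mixPoint hX α z y)) := fun x y z α hα => by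
    rw [mixPoint_symm hX α, mixPoint_symm hX α z y]
    exact hind x y z _ (symm_mem_Ioo hα)
  have hmix : ∀ x x' y y', ∀ α ∈ Set.Ioo (0 : unitInterval) 1, r x x' → r y y' →
      r (mixPoint hX α x y) (mixPoint hX α x' y') := fun x x' y y' α hα h1 h2 =>
    htrans _ _ _ ((hind _ _ y α hα).1 h1) ((hind' _ _ x' α hα).1 h2)
  have hstrict : ∀ x x' y y', ∀ α ∈ Set.Ioo (0 : unitInterval) 1, ¬ r x' x → r y y' →
      ¬ r (mixPoint hX α x' y') (mixPoint hX α x y) := fun x x' y y' α hα h1 h2 h =>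
    h1 ((hind _ _ y' α hα).2 (htrans _ _ _ h ((hind' _ _ x α hα).1 h2)))
  -- Mixing the pairs `(x, x')` and `(y, y')` adds positive multiples of their differences.
  have hwt : ∀ {s t : ℝ}, 0 < s → 0 < t → ∃ α ∈ Set.Ioo (0 : unitInterval) 1,
      ∀ x x' y y' : X, s • ((x : E) - x') + t • ((y : E) - y') =
        (s + t) • ((mixPoint hX α x y : E) - mixPoint hX α x' y') := by
    intro s t hs ht
    obtain ⟨α, hα, hαe⟩ := exists_unitInterval (t := s / (s + t)) (by positivity)
      ((div_lt_one (by positivity)).2 (by linarith))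
    refine ⟨α, hα, fun x x' y y' => ?_⟩
    have hs' : s = (s + t) * α := by rw [hαe]; field_simp
    have ht' : t = (s + t) * (1 - α) := by rw [hαe]; field_simp; ring
    rw [show s • ((x : E) - x') + t • ((y : E) - y') = ((s + t) * α) • ((x : E) - x') +
      ((s + t) * (1 - α)) • ((y : E) - y') by rw [← hs', ← ht']]
    simp only [mixPoint]
    module
  let C : ConvexCone ℝ E :=
    { carrier := {v | ∃ t : ℝ, 0 < t ∧ ∃ x y : X, r x y ∧ v = t • ((x : E) - y)}
      smul_mem' := by
        rintro c hc _ ⟨t, ht, x, y, hxy, rfl⟩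
        exact ⟨c * t, mul_pos hc ht, x, y, hxy, smul_smul c t _⟩
      add_mem' := by
        rintro _ ⟨s, hs, x, x', hx, rfl⟩ _ ⟨t, ht, y, y', hy, rfl⟩
        obtain ⟨α, hα, hsum⟩ := hwt hs ht
        exact ⟨s + t, add_pos hs ht, _, _, hmix x x' y y' α hα hx hy, hsum x x' y y'⟩ }
  have hCiff : ∀ {t : ℝ}, 0 < t → ∀ x y : X, t • ((x : E) - y) ∈ C ↔ r x y := by
    refine fun {t} ht x y => ⟨?_, fun h => ⟨t, ht, x, y, h, rfl⟩⟩
    rintro ⟨s, hs, x', y', h, heq⟩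
    by_contra hxy
    obtain ⟨α, hα, hsum⟩ := hwt ht hs
    have h1 := hsum y x x' y'
    rw [← heq, ← smul_add, sub_add_sub_cancel, sub_self, smul_zero, eq_comm,
      smul_eq_zero_iff_right (by positivity), sub_eq_zero] at h1
    have h2 := hstrict y x x' y' α hα hxy h
    rw [Subtype.ext h1] at h2
    exact h2 (hrefl _)
  obtain ⟨x₁, x₀, h10⟩ := hnt
  let W : Submodule ℝ E :=
    { carrier := {v | ∃ t : ℝ, 0 < t ∧ ∃ x y : X, v = t • ((x : E) - y)}
      zero_mem' := ⟨1, one_pos, x₀, x₀, by simp⟩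
      add_mem' := by
        rintro _ _ ⟨s, hs, x, x', rfl⟩ ⟨t, ht, y, y', rfl⟩
        obtain ⟨α, -, hsum⟩ := hwt hs ht
        exact ⟨s + t, add_pos hs ht, _, _, hsum x x' y y'⟩
      smul_mem' := by
        rintro c _ ⟨t, ht, x, y, rfl⟩
        rcases lt_trichotomy c 0 with hc | rfl | hc
        · exact ⟨-c * t, mul_pos (neg_pos.2 hc) ht, y, x, by module⟩
        · exact ⟨1, one_pos, x₀, x₀, by simp⟩
        · exact ⟨c * t, mul_pos hc ht, x, y, smul_smul c t _⟩ }
  have hW : ∀ x y : X, (x : E) - y ∈ W := fun x y => ⟨1, one_pos, x, y, by simp⟩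
  have hneg : ∀ (t : ℝ) (x y : X), -(t • ((x : E) - y)) = t • ((y : E) - x) := fun t x y => by
    module
  obtain ⟨l, hl⟩ := exists_linearMap_of_archimedean_cone W C
    (by
      rintro _ ⟨t, ht, x, y, rfl⟩
      rw [hneg, hCiff ht, hCiff ht]
      exact hcomp x y)
    (by
      rintro _ ⟨s, hs, x, y, rfl⟩ hv _ ⟨t, ht, z, z', rfl⟩
      rw [hneg, hCiff hs] at hv
      by_cases hz : r z z'
      · obtain ⟨α, hα, hsum⟩ := hwt hs ht
        refine ⟨1, one_pos, ?_⟩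
        rw [one_smul, hsum, hneg, hCiff (add_pos hs ht)]
        exact hstrict x y z z' α hα hv hz
      · -- Apply the Archimedean axiom to the half-half mixtures of `(x, z')`, `(y, z')`, `(y, z)`.
        obtain ⟨β, hβ, hβe⟩ := exists_unitInterval (t := 1 / 2) (by norm_num) (by norm_num)
        obtain ⟨α, hα, h⟩ := harch (mixPoint hX β x z') (mixPoint hX β y z') (mixPoint hX β y z)
          (hstrict _ _ _ _ β hβ hv (hrefl z'))
          (fun h => hz ((hind' _ _ y β hβ).2 h))
        have hα0 : 0 < (α : ℝ) := hα.1
        have hα1 : 0 < 1 - (α : ℝ) := sub_pos.2 hα.2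
        refine ⟨s * (1 - α) / (α * t), by positivity, fun hC => h ?_⟩
        rw [← hCiff (t := 2 * s / α) (by positivity)]
        convert hC using 1
        rw [smul_smul, show s * (1 - (α : ℝ)) / (α * t) * t = s * (1 - α) / α by field_simp]
        simp only [mixPoint, hβe]
        match_scalars <;> field_simp <;> ring)
    (hW x₁ x₀)
    (by
      rw [neg_sub, ← one_smul ℝ ((x₀ : E) - x₁), hCiff one_pos]
      exact h10)
  have hrep : ∀ x y : X, r x y ↔ l ⟨_, hW y x₀⟩ ≤ l ⟨_, hW x x₀⟩ := fun x y => by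
    have : (⟨_, hW x y⟩ : W) = ⟨_, hW x x₀⟩ - ⟨_, hW y x₀⟩ := by
      ext1
      simp
    rw [← hCiff one_pos, one_smul, hl ⟨_, hW x y⟩, this, map_sub, sub_nonneg]
  refine ⟨fun x => l ⟨_, hW x x₀⟩, ⟨⟨x₁, x₀, fun h => h10 ((hrep _ _).2 h.le)⟩, fun α x y => ?_⟩,
    hrep⟩
  rw [← smul_eq_mul, ← smul_eq_mul, ← map_smul, ← map_smul, ← map_add]
  refine congrArg l (Subtype.ext ?_)
  simp only [mixPoint, Submodule.coe_add, Submodule.coe_smul]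
  module

/-- The values of an affine function form an interval. -/
theorem NonconstantAffine.exists_eq {hX : Convex ℝ X} {u : X → ℝ} (hu : NonconstantAffine hX u)
    {x y : X} {t : ℝ} (hx : u x ≤ t) (hy : t ≤ u y) : ∃ z, u z = t := by
  rcases (hx.trans hy).eq_or_lt with h | h
  · exact ⟨x, by linarith⟩
  · have hpos : 0 < u y - u x := sub_pos.2 h
    refine ⟨mixPoint hX ⟨(t - u x) / (u y - u x), div_nonneg (by linarith) hpos.le,
      (div_le_one hpos).2 (by linarith)⟩ y x, ?_⟩
    rw [hu.2]
    field_simp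
    ring

theorem NonconstantAffine.neg {hX : Convex ℝ X} {u : X → ℝ} (hu : NonconstantAffine hX u) :
    NonconstantAffine hX fun x => -u x := by
  obtain ⟨⟨x, y, hxy⟩, haff⟩ := hu
  exact ⟨⟨x, y, fun h => hxy (neg_injective h)⟩, fun α x y => by simp only [haff]; ring⟩

theorem NonconstantAffine.affine {hX : Convex ℝ X} {u : X → ℝ} (hu : NonconstantAffine hX u)
    {a : ℝ} (ha : 0 < a) (b : ℝ) : NonconstantAffine hX fun x => a * u x + b := by
  obtain ⟨⟨x, y, hxy⟩, haff⟩ := hu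
  refine ⟨⟨x, y, fun h => hxy ?_⟩, fun α x y => by simp only [haff]; ring⟩
  exact mul_left_cancel₀ ha.ne' (add_right_cancel h)

/-- Cardinal uniqueness: affine functions that induce the same ordering are positive affine
transformations of each other. -/
theorem NonconstantAffine.eq_affine {hX : Convex ℝ X} {u v : X → ℝ} (hu : NonconstantAffine hX u)
    (hv : NonconstantAffine hX v) (h : ∀ x y, u y ≤ u x ↔ v y ≤ v x) :
    ∃ a b : ℝ, 0 < a ∧ ∀ x, v x = a * u x + b := by
  have hcol : ∀ x y z, u x ≤ u y → u y ≤ u z →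
      (u y - u x) * (v z - v x) = (v y - v x) * (u z - u x) := by
    intro x y z hxy hyz
    rcases (hxy.trans hyz).eq_or_lt with hxz | hxz
    · have h1 : u y = u x := by linarith
      have h2 : v y = v x := le_antisymm ((h _ _).1 h1.le) ((h _ _).1 h1.ge)
      rw [h1, h2]
      ring
    · have hpos : 0 < u z - u x := sub_pos.2 hxz
      set α : unitInterval := ⟨(u y - u x) / (u z - u x), div_nonneg (by linarith) hpos.le,
        (div_le_one hpos).2 (by linarith)⟩ with hα
      have h1 : u (mixPoint hX α z x) = u y := by
        rw [hu.2, hα]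
        field_simp
        ring
      have h2 : v (mixPoint hX α z x) = v y := le_antisymm ((h _ _).1 h1.le) ((h _ _).1 h1.ge)
      rw [← h2, ← h1, hv.2, hu.2]
      ring
  obtain ⟨x₀, x₁, h01⟩ : ∃ x₀ x₁, u x₀ < u x₁ := by
    obtain ⟨⟨x, y, hxy⟩, -⟩ := hu
    rcases lt_or_gt_of_ne hxy with hlt | hlt
    exacts [⟨x, y, hlt⟩, ⟨y, x, hlt⟩]
  have hv01 : v x₀ < v x₁ := not_le.1 fun hle => h01.not_ge ((h _ _).2 hle)
  have hd : 0 < u x₁ - u x₀ := sub_pos.2 h01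
  refine ⟨(v x₁ - v x₀) / (u x₁ - u x₀), v x₀ - (v x₁ - v x₀) / (u x₁ - u x₀) * u x₀,
    div_pos (sub_pos.2 hv01) hd, fun z => ?_⟩
  have key : (u x₁ - u x₀) * (v z - v x₀) = (v x₁ - v x₀) * (u z - u x₀) := by
    rcases le_total (u z) (u x₀) with hz | hz
    · linear_combination hcol z x₀ x₁ hz h01.le
    · rcases le_total (u z) (u x₁) with hz' | hz'
      · linear_combination -hcol x₀ z x₁ hz hz'
      · exact hcol x₀ x₁ z h01.le hz'
  field_simp
  linear_combination key

end Utility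

/-! ### Duality between the two representations -/

section Duality

open FinAddProb

variable {S : Type*} {𝒜 : BooleanSubalgebra (Set S)} {E : Type*} {X : Set E}
  {R : Act 𝒜 X → Act 𝒜 X → Prop} {u : X → ℝ}

theorem isMax_iff_isMin_neg {Y : Type*} (P : Set (FinAddProb 𝒜)) (f : SimpleMap 𝒜 Y)
    (u : Y → ℝ) (m : ℝ) :
    IsMax P (f.map u) m ↔ IsMin P (f.map fun x => -u x) (-m) := by
  simp only [FinAddProb.IsMax, FinAddProb.IsMin, IsGreatest, IsLeast, upperBounds, lowerBounds, integral_map_neg,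
    Set.mem_image, Set.mem_ofPred_eq, forall_exists_index, and_imp, forall_apply_eq_imp_iff₂,
    neg_le_neg_iff, neg_inj]

theorem isMinMax_iff_isMaxMin_neg {Y : Type*} (Ps : Set (Set (FinAddProb 𝒜)))
    (f : SimpleMap 𝒜 Y) (u : Y → ℝ) (v : ℝ) : IsMinMax Ps (f.map u) v ↔ IsMaxMin Ps (f.map fun x => -u x) (-v) := by
  simp only [IsMinMax, IsMaxMin, IsGreatest, IsLeast, upperBounds, lowerBounds,
    isMax_iff_isMin_neg, Set.mem_ofPred_eq]
  refine and_congr_right fun _ => ⟨fun h m hm => ?_, fun h m hm => ?_⟩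
  · have := @h (-m) (by simpa using hm)
    linarith
  · have := @h (-m) hm
    linarith

theorem minMaxRep_iff (Qs : Set (Set (FinAddProb 𝒜))) :
    MinMaxRep R u Qs ↔ MaxMinRep (fun f g => R g f) (fun x => -u x) Qs := by
  refine and_congr_right fun _ => ⟨?_, ?_⟩
  · rintro ⟨V, hV, hR⟩
    exact ⟨fun f => -V f, fun f => (isMinMax_iff_isMaxMin_neg _ _ _ _).1 (hV f),
      fun f g => by simp only [hR, ge_iff_le, neg_le_neg_iff]⟩
  · rintro ⟨V, hV, hR⟩
    exact ⟨fun f => -V f, fun f => (isMinMax_iff_isMaxMin_neg _ _ _ _).2 (by simpa using hV f),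
      fun f g => by simp only [hR, ge_iff_le, neg_le_neg_iff]⟩

theorem maximalMinMaxFamily_eq : maximalMinMaxFamily R u =
    maximalMaxMinFamily (fun f g => R g f) (fun x => -u x) := by
  ext Q
  refine and_congr_right fun _ => forall_congr' fun f => forall_congr' fun x =>
    imp_congr and_comm ⟨?_, ?_⟩
  · rintro ⟨m, hm, hle⟩
    exact ⟨-m, (isMax_iff_isMin_neg _ _ _ _).1 hm, neg_le_neg hle⟩
  · rintro ⟨m, hm, hle⟩
    exact ⟨-m, (isMax_iff_isMin_neg _ _ _ _).2 (by simpa using hm), le_neg_of_le_neg hle⟩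

end Duality

/-! ### Preferences represented by a certainty-equivalent functional -/

section Representation

open FinAddProb

variable {S : Type*} {𝒜 : BooleanSubalgebra (Set S)}
  {E : Type*} [AddCommGroup E] [Module ℝ E] {X : Set E}

/-- `V` represents `R`, agrees with `u` on constant acts, and, as a function of the utility
profile `u(f)`, is affine under mixing with constants and monotone up to adding constants. This is
the common form of the max-min and the min-max criterion. -/
structure Represents (hX : Convex ℝ X) (R : Act 𝒜 X → Act 𝒜 X → Prop) (u : X → ℝ)
    (V : Act 𝒜 X → ℝ) : Prop where
  le_iff : ∀ f g, R f g ↔ V g ≤ V f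
  const : ∀ x, V (SimpleMap.const 𝒜 x) = u x
  mix : ∀ (f : Act 𝒜 X) (x : X), ∀ α ∈ Set.Ioo (0 : unitInterval) 1,
    V (mixAct hX α f (SimpleMap.const 𝒜 x)) = α * V f + (1 - α) * u x
  translate : ∀ (f g : Act 𝒜 X) (c : ℝ), (∀ s, u (f s) + c ≤ u (g s)) → V f + c ≤ V g

variable {hX : Convex ℝ X} {R : Act 𝒜 X → Act 𝒜 X → Prop} {u : X → ℝ} {V : Act 𝒜 X → ℝ}

theorem SimpleMap.exists_extremes [Nonempty S] {Y : Type*} (f : SimpleMap 𝒜 Y) (k : Y → ℝ) :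
    ∃ s₀ s₁, ∀ s, k (f s₀) ≤ k (f s) ∧ k (f s) ≤ k (f s₁) := by
  have hne : (Set.range f.toFun).Nonempty := Set.range_nonempty _
  obtain ⟨_, ⟨s₀, rfl⟩, h₀⟩ := Set.exists_min_image _ k f.finite_range hne
  obtain ⟨_, ⟨s₁, rfl⟩, h₁⟩ := Set.exists_max_image _ k f.finite_range hne
  exact ⟨s₀, s₁, fun s => ⟨h₀ _ ⟨s, rfl⟩, h₁ _ ⟨s, rfl⟩⟩⟩

theorem Represents.mono (h : Represents hX R u V) {f g : Act 𝒜 X}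
    (hfg : ∀ s, u (f s) ≤ u (g s)) : V f ≤ V g := by
  simpa using h.translate f g 0 (by simpa using hfg)

theorem Represents.mix_of_unitInterval (h : Represents hX R u V) (hu : NonconstantAffine hX u)
    (f : Act 𝒜 X) (x : X) (α : unitInterval) :
    V (mixAct hX α f (SimpleMap.const 𝒜 x)) = α * V f + (1 - α) * u x := by
  have hval : ∀ s, u (mixAct hX α f (SimpleMap.const 𝒜 x) s) = α * u (f s) + (1 - α) * u x :=
    fun s => hu.2 α (f s) x
  rcases eq_or_ne α 0 with rfl | h0
  · rw [← h.const x]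
    simp only [Set.Icc.coe_zero, zero_mul, sub_zero, one_mul, zero_add] at hval ⊢
    exact le_antisymm (h.mono fun s => (hval s).le) (h.mono fun s => (hval s).ge)
  rcases eq_or_ne α 1 with rfl | h1
  · simp only [Set.Icc.coe_one, sub_self, zero_mul, one_mul, add_zero] at hval ⊢
    exact le_antisymm (h.mono fun s => (hval s).le) (h.mono fun s => (hval s).ge)
  · exact h.mix f x α ⟨bot_lt_iff_ne_bot.2 h0, lt_top_iff_ne_top.2 h1⟩

theorem Represents.certaintyEquivalent_iff (h : Represents hX R u V) {f : Act 𝒜 X} {x : X} :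
    CertaintyEquivalent R f x ↔ u x = V f := by
  rw [CertaintyEquivalent, Indifferent, h.le_iff, h.le_iff, h.const]
  exact ⟨fun hx => le_antisymm hx.2 hx.1, fun hx => ⟨hx.ge, hx.le⟩⟩

theorem Represents.exists_eq [Nonempty S] (h : Represents hX R u V)
    (hu : NonconstantAffine hX u) (f : Act 𝒜 X) : ∃ x, u x = V f := by
  obtain ⟨s₀, s₁, hs⟩ := f.exists_extremes u
  refine hu.exists_eq (x := f s₀) (y := f s₁) ?_ ?_
  · rw [← h.const]
    exact h.mono fun s => (hs s).1
  · rw [← h.const]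
    exact h.mono fun s => (hs s).2

theorem Represents.affine (h : Represents hX R u V) {a : ℝ} (ha : 0 < a) (b : ℝ) :
    Represents hX R (fun x => a * u x + b) (fun f => a * V f + b) where
  le_iff := fun f g => by
    rw [h.le_iff, add_le_add_iff_right, mul_le_mul_iff_right₀ ha]
  const := fun x => by simp only [h.const]
  mix := fun f x α hα => by simp only [h.mix f x α hα]; ring
  translate := fun f g c hc => by
    have := h.translate f g (c / a) fun s => by
      have hs := hc s
      rw [← le_sub_iff_add_le', div_le_iff₀ ha]
      linarith
    have := mul_le_mul_of_nonneg_left this ha.le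
    rw [mul_add, mul_div_cancel₀ _ ha.ne'] at this
    linarith

/-- Reversing the preference and changing the sign of utility exchanges maxima and minima. -/
theorem Represents.dual (h : Represents hX R u V) :
    Represents hX (fun f g => R g f) (fun x => -u x) (fun f => -V f) where
  le_iff := fun f g => by rw [h.le_iff, neg_le_neg_iff]
  const := fun x => by simp only [h.const]
  mix := fun f x α hα => by simp only [h.mix f x α hα]; ring
  translate := fun f g c hc => by
    linarith [h.translate g f c fun s => by linarith [hc s]]

theorem Represents.invariantBiseparable [Nonempty S] (h : Represents hX R u V)
    (hu : NonconstantAffine hX u) : InvariantBiseparable hX R := by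
  have hst : ∀ f g, Strictly R f g ↔ V g < V f := fun f g => by
    rw [Strictly, h.le_iff, h.le_iff, not_le]
    exact ⟨And.right, fun hlt => ⟨hlt.le, hlt⟩⟩
  refine ⟨⟨?_, fun f g => ?_, fun f g k h1 h2 => ?_⟩, fun f g hfg => ?_, fun f g k hfg hgk => ?_,
    fun f g x α hα => ?_⟩
  · obtain ⟨⟨x, y, hxy⟩, -⟩ := hu
    simp only [hst]
    rw [← h.const x, ← h.const y] at hxy
    rcases lt_or_gt_of_ne hxy with hlt | hlt
    exacts [⟨_, _, hlt⟩, ⟨_, _, hlt⟩]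
  · rw [h.le_iff, h.le_iff]
    exact le_total _ _
  · rw [h.le_iff] at *
    exact h2.trans h1
  · rw [h.le_iff]
    refine h.mono fun s => ?_
    have := hfg s
    rwa [h.le_iff, h.const, h.const] at this
  · rw [hst] at hfg hgk
    obtain ⟨K, hK⟩ : ∃ K, ∀ s, |u (f s) - u (k s)| ≤ K := by
      obtain ⟨_, s₁, hs⟩ := (f.pair k).exists_extremes fun y => |u y.1 - u y.2|
      exact ⟨_, fun s => (hs s).2⟩
    have hsmall : ∀ d : ℝ, 0 < d → ∃ α ∈ Set.Ioo (0 : unitInterval) 1, α * K < d := by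
      intro d hd
      have hK' : 0 < |K| + 1 := by positivity
      obtain ⟨α, hα, hαe⟩ := exists_unitInterval (t := min (1 / 2) (d / (|K| + 1)))
        (lt_min (by norm_num) (div_pos hd hK')) ((min_le_left _ _).trans_lt (by norm_num))
      have hα0 : (0 : ℝ) < α := hα.1
      refine ⟨α, hα, ?_⟩
      calc (α : ℝ) * K ≤ α * |K| := mul_le_mul_of_nonneg_left (le_abs_self K) hα0.le
        _ < α * (|K| + 1) := mul_lt_mul_of_pos_left (lt_add_one _) hα0
        _ ≤ d / (|K| + 1) * (|K| + 1) :=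
          mul_le_mul_of_nonneg_right (hαe ▸ min_le_right _ _) hK'.le
        _ = d := div_mul_cancel₀ _ hK'.ne'
    have hval : ∀ (α : unitInterval) s,
        u (mixAct hX α f k s) = α * u (f s) + (1 - α) * u (k s) := fun α s => hu.2 α (f s) (k s)
    obtain ⟨β, hβ, hβK⟩ := hsmall _ (sub_pos.2 hfg)
    obtain ⟨γ, hγ, hγK⟩ := hsmall _ (sub_pos.2 hgk)
    refine ⟨unitInterval.symm β, symm_mem_Ioo hβ, γ, hγ, (hst _ _).2 ?_, (hst _ _).2 ?_⟩
    · have := h.translate f (mixAct hX (unitInterval.symm β) f k) (-(β * K)) fun s => by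
        rw [hval, unitInterval.coe_symm_eq]
        have := mul_le_mul_of_nonneg_left (abs_le.1 (hK s)).2 β.2.1
        linarith
      linarith
    · have := h.translate (mixAct hX γ f k) k (-(γ * K)) fun s => by
        rw [hval]
        have := mul_le_mul_of_nonneg_left (abs_le.1 (hK s)).2 γ.2.1
        linarith
      linarith
  · rw [h.le_iff, h.le_iff, h.mix _ _ _ hα, h.mix _ _ _ hα, add_le_add_iff_right,
      mul_le_mul_iff_right₀ (show (0 : ℝ) < α from hα.1)]

/-! ### From the axioms to a certainty-equivalent functional -/

theorem InvariantBiseparable.exists_utility [Nonempty S] (h : InvariantBiseparable hX R) :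
    ∃ u : X → ℝ, NonconstantAffine hX u ∧
      ∀ x y, R (SimpleMap.const 𝒜 x) (SimpleMap.const 𝒜 y) ↔ u y ≤ u x := by
  obtain ⟨⟨⟨f, g, hfg⟩, hcomp, htrans⟩, hmono, harch, hind⟩ := h
  refine exists_affine_utility hX (fun x y => R (SimpleMap.const 𝒜 x) (SimpleMap.const 𝒜 y)) ?_
    (fun x y => hcomp _ _) (fun x y z => htrans _ _ _) (fun x y z hxy hyz => ?_)
    (fun x y z α hα => hind _ _ z α hα)
  · -- If all constant acts were indifferent, all acts would be, by monotonicity.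
    by_contra! hall
    exact hfg.2 (hmono _ _ fun s => hall _ _)
  · obtain ⟨α, hα, -, -, h1, -⟩ := harch (SimpleMap.const 𝒜 x) (SimpleMap.const 𝒜 y)
      (SimpleMap.const 𝒜 z) ⟨(hcomp _ _).resolve_right hxy, hxy⟩
      ⟨(hcomp _ _).resolve_right hyz, hyz⟩
    exact ⟨α, hα, h1.2⟩

theorem InvariantBiseparable.exists_certaintyEquivalent [Nonempty S]
    (h : InvariantBiseparable hX R) (f : Act 𝒜 X) : ∃ x, CertaintyEquivalent R f x := by
  obtain ⟨u, hu, hrep⟩ := h.exists_utility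
  obtain ⟨⟨-, hcomp, htrans⟩, hmono, harch, -⟩ := h
  obtain ⟨s₀, s₁, hs⟩ := f.exists_extremes u
  have hlow : R f (SimpleMap.const 𝒜 (f s₀)) := hmono _ _ fun s => (hrep _ _).2 (hs s).1
  have hhigh : R (SimpleMap.const 𝒜 (f s₁)) f := hmono _ _ fun s => (hrep _ _).2 (hs s).2
  by_cases h0 : R (SimpleMap.const 𝒜 (f s₀)) f
  · exact ⟨_, h0, hlow⟩
  by_cases h1 : R f (SimpleMap.const 𝒜 (f s₁))
  · exact ⟨_, hhigh, h1⟩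
  -- The candidate has the supremum of the utilities of the consequences that `f` dominates.
  set T : Set ℝ := {t | ∃ x, R f (SimpleMap.const 𝒜 x) ∧ u x = t} with hT
  have hmem : u (f s₀) ∈ T := ⟨_, hlow, rfl⟩
  have hub : u (f s₁) ∈ upperBounds T := by
    rintro _ ⟨x, hx, rfl⟩
    exact (hrep _ _).1 (htrans _ _ _ hhigh hx)
  obtain ⟨z, hz⟩ := hu.exists_eq (le_csSup ⟨_, hub⟩ hmem) (csSup_le ⟨_, hmem⟩ hub)
  refine ⟨z, ?_, ?_⟩
  · by_contra hzf
    obtain ⟨-, -, β, hβ, -, hb⟩ := harch (SimpleMap.const 𝒜 (f s₁)) f (SimpleMap.const 𝒜 z)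
      ⟨hhigh, h1⟩ ⟨(hcomp _ _).resolve_right hzf, hzf⟩
    have hle : u (mixPoint hX β (f s₁) z) ≤ u z := by
      rw [hz]
      exact le_csSup ⟨_, hub⟩ ⟨mixPoint hX β (f s₁) z, hb.1, rfl⟩
    have hlt : u z < u (f s₁) := not_le.1 fun hle =>
      hzf (htrans _ _ _ ((hrep _ _).2 hle) hhigh)
    rw [hu.2] at hle
    have hβ0 : (0 : ℝ) < β := hβ.1
    nlinarith [mul_pos hβ0 (sub_pos.2 hlt)]
  · by_contra hfz
    obtain ⟨α, hα, -, -, ha, -⟩ := harch (SimpleMap.const 𝒜 z) f (SimpleMap.const 𝒜 (f s₀))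
      ⟨(hcomp _ _).resolve_left hfz, hfz⟩ ⟨hlow, h0⟩
    have hlt : u (f s₀) < u z := not_le.1 fun hle =>
      hfz (htrans _ _ _ hlow ((hrep _ _).2 hle))
    have hlt' : u (mixPoint hX α z (f s₀)) < sSup T := by
      rw [← hz, hu.2]
      have hα1 : (0 : ℝ) < 1 - α := sub_pos.2 hα.2
      nlinarith [mul_pos hα1 (sub_pos.2 hlt)]
    obtain ⟨_, ⟨x, hx, rfl⟩, hxlt⟩ := exists_lt_of_lt_csSup ⟨_, hmem⟩ hlt'
    exact ha.2 (htrans _ _ _ hx ((hrep _ _).2 hxlt.le))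

theorem InvariantBiseparable.exists_represents [Nonempty S] (h : InvariantBiseparable hX R) :
    ∃ u, NonconstantAffine hX u ∧ ∃ V, Represents hX R u V := by
  obtain ⟨u, hu, hrep⟩ := h.exists_utility
  choose ce hce using h.exists_certaintyEquivalent
  obtain ⟨⟨-, hcomp, htrans⟩, hmono, -, hind⟩ := h
  have hiff : ∀ f g, R f g ↔ u (ce g) ≤ u (ce f) := fun f g => by
    rw [← hrep]
    exact ⟨fun hfg => htrans _ _ _ (hce f).1 (htrans _ _ _ hfg (hce g).2),
      fun hfg => htrans _ _ _ (hce f).2 (htrans _ _ _ hfg (hce g).1)⟩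
  have huniq : ∀ f x, CertaintyEquivalent R f x → u (ce f) = u x := fun f x hx =>
    le_antisymm ((hrep _ _).1 (htrans _ _ _ hx.1 (hce f).2))
      ((hrep _ _).1 (htrans _ _ _ (hce f).1 hx.2))
  have hmix : ∀ (f : Act 𝒜 X) (x : X), ∀ α ∈ Set.Ioo (0 : unitInterval) 1,
      u (ce (mixAct hX α f (SimpleMap.const 𝒜 x))) = α * u (ce f) + (1 - α) * u x :=
    fun f x α hα => by
      rw [← hu.2]
      exact huniq _ _ ⟨(hind _ _ x α hα).1 (hce f).1, (hind _ _ x α hα).1 (hce f).2⟩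
  refine ⟨u, hu, fun f => u (ce f), hiff, fun x => ?_, hmix, fun f g c hfg => ?_⟩
  · have hr : R (SimpleMap.const 𝒜 x) (SimpleMap.const 𝒜 x) := (hcomp _ _).elim id id
    exact huniq _ _ ⟨hr, hr⟩
  · by_contra! hlt
    -- The constant `c` is a utility difference, so it can be added by mixing with constants.
    obtain ⟨a, b, hab⟩ : ∃ a b, u a = u b + c := by
      rcases le_total 0 c with hc | hc
      · obtain ⟨s⟩ := ‹Nonempty S›
        obtain ⟨z, hz⟩ := hu.exists_eq (x := f s) (y := g s) (t := u (f s) + c)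
          (by linarith) (hfg s)
        exact ⟨z, _, hz⟩
      · obtain ⟨z, hz⟩ := hu.exists_eq (x := ce g) (y := ce f) (t := u (ce f) + c)
          hlt.le (by linarith)
        exact ⟨z, _, hz⟩
    obtain ⟨α, hα, hαe⟩ := exists_unitInterval (t := 1 / 2) (by norm_num) (by norm_num)
    have hR : R (mixAct hX α g (SimpleMap.const 𝒜 b)) (mixAct hX α f (SimpleMap.const 𝒜 a)) := by
      refine hmono _ _ fun s => (hrep _ _).2 ?_
      change u (mixPoint hX α (f s) a) ≤ u (mixPoint hX α (g s) b)
      rw [hu.2, hu.2, hαe]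
      linarith [hfg s]
    rw [hiff, hmix _ _ _ hα, hmix _ _ _ hα, hαe] at hR
    linarith

/-! ### Max-min representations -/

theorem integral_mixAct (hu : NonconstantAffine hX u) (p : FinAddProb 𝒜) (f : Act 𝒜 X) (x : X)
    (α : unitInterval) : p.integral ((mixAct hX α f (SimpleMap.const 𝒜 x)).map u) =
      α * p.integral (f.map u) + (1 - α) * u x := by
  have hmap : (mixAct hX α f (SimpleMap.const 𝒜 x)).map u =
      f.map fun y => α * u y + (1 - α) * u x := by
    have : ((mixAct hX α f (SimpleMap.const 𝒜 x)).map u).toFun =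
        (f.map fun y => α * u y + (1 - α) * u x).toFun := funext fun s => hu.2 α (f s) x
    revert this
    generalize (mixAct hX α f (SimpleMap.const 𝒜 x)).map u = φ
    generalize (f.map fun y => α * u y + (1 - α) * u x) = ψ
    intro this
    cases φ
    cases ψ
    congr
  rw [hmap, p.integral_map_linear f α (1 - α) u fun _ => u x, integral_map_const]

theorem MaxMinRep.exists_represents (hu : NonconstantAffine hX u)
    {Ps : Set (Set (FinAddProb 𝒜))} (h : MaxMinRep R u Ps) :
    ∃ V, (∀ f, IsMaxMin Ps (f.map u) (V f)) ∧ Represents hX R u V := by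
  obtain ⟨hPs, V, hV, hrep⟩ := h
  refine ⟨V, hV, hrep, fun x => ?_, fun f x α hα => ?_, fun f g c hc => ?_⟩
  · obtain ⟨⟨P, -, ⟨p, -, hp⟩, -⟩, -⟩ := hV (SimpleMap.const 𝒜 x)
    exact hp.symm.trans (p.integral_map_const (SimpleMap.const 𝒜 x) (u x))
  · have hα0 : (0 : ℝ) < α := hα.1
    refine le_antisymm ?_ ?_
    · obtain ⟨⟨P, hP, -, hm⟩, -⟩ := hV (mixAct hX α f (SimpleMap.const 𝒜 x))
      obtain ⟨m, hmin⟩ := (hPs P hP).exists_isMin (f.map u)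
      have hle : m ≤ V f := (hV f).2 ⟨P, hP, hmin⟩
      obtain ⟨p, hp, rfl⟩ := hmin.1
      have := hm ⟨p, hp, rfl⟩
      dsimp only at this
      rw [integral_mixAct hu] at this
      have := mul_le_mul_of_nonneg_left hle hα0.le
      linarith
    · obtain ⟨⟨P, hP, -, hm⟩, -⟩ := hV f
      obtain ⟨m, hmin⟩ := (hPs P hP).exists_isMin ((mixAct hX α f (SimpleMap.const 𝒜 x)).map u)
      have hle := (hV (mixAct hX α f (SimpleMap.const 𝒜 x))).2 ⟨P, hP, hmin⟩
      obtain ⟨p, hp, rfl⟩ := hmin.1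
      have := mul_le_mul_of_nonneg_left (hm ⟨p, hp, rfl⟩) hα0.le
      dsimp only at this hle
      rw [integral_mixAct hu] at hle
      linarith
  · obtain ⟨⟨P, hP, -, hm⟩, -⟩ := hV f
    obtain ⟨m, hmin⟩ := (hPs P hP).exists_isMin (g.map u)
    have hle := (hV g).2 ⟨P, hP, hmin⟩
    obtain ⟨p, hp, rfl⟩ := hmin.1
    have h1 := hm ⟨p, hp, rfl⟩
    have h2 := p.integral_add_const_le f g u c hc
    dsimp only at h1 hle
    linarith

/-- The heart of the representation: for any two acts some prior evaluates the first one at least,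
and the second one at most, as highly as the preference does. Otherwise the pairs of integrals
could be separated from a quadrant, and mixing one act with its certainty equivalent would
contradict monotonicity. -/
theorem Represents.exists_prob [Nonempty S] (h : Represents hX R u V)
    (hu : NonconstantAffine hX u) (f g : Act 𝒜 X) :
    ∃ p : FinAddProb 𝒜, V f ≤ p.integral (f.map u) ∧ p.integral (g.map u) ≤ V g := by
  by_contra! hno
  set F : FinAddProb 𝒜 → ℝ × ℝ := fun p => (p.integral (f.map u), p.integral (g.map u)) with hF
  have hcompact : IsCompact (F '' Set.univ) :=
    FinAddProb.isCompact_univ.image ((continuous_integral _).prodMk (continuous_integral _))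
  have hconv : Convex ℝ (F '' Set.univ) := by
    rintro _ ⟨p, -, rfl⟩ _ ⟨q, -, rfl⟩ a b ha hb hab
    refine ⟨FinAddProb.mix a b ha hb hab p q, trivial, ?_⟩
    simp only [hF, integral_mix, Prod.smul_mk, Prod.mk_add_mk, smul_eq_mul]
  have hdisj : Disjoint (F '' Set.univ) (Set.Ici (V f) ×ˢ Set.Iic (V g)) := by
    rw [Set.disjoint_left]
    rintro _ ⟨p, -, rfl⟩ ⟨h1, h2⟩
    exact (hno p h1).not_ge h2
  obtain ⟨l, c, d, hlc, hcd, hld⟩ := geometric_hahn_banach_compact_closed hconv hcompact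
    ((convex_Ici (V f)).prod (convex_Iic (V g))) (isClosed_Ici.prod isClosed_Iic) hdisj
  obtain ⟨a, b, hl⟩ : ∃ a b : ℝ, ∀ x y : ℝ, l (x, y) = a * x - b * y := by
    refine ⟨l (1, 0), -l (0, 1), fun x y => ?_⟩
    have : ((x, y) : ℝ × ℝ) = x • (1, 0) + y • (0, 1) := by simp
    rw [this, map_add, map_smul, map_smul, smul_eq_mul, smul_eq_mul]
    ring
  have hquad : ∀ x y : ℝ, V f ≤ x → y ≤ V g → d < a * x - b * y := fun x y hx hy =>
    (hld (x, y) ⟨hx, hy⟩).trans_eq (hl x y)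
  have hcorner := hquad _ _ le_rfl le_rfl
  -- The functional is bounded below on the quadrant, so both coefficients are nonnegative.
  have ha : 0 ≤ a := by
    by_contra! hneg
    have h1 := hquad (V f + (a * V f - b * V g - d) / (-a)) (V g)
      (le_add_of_nonneg_right (div_nonneg (by linarith) (by linarith))) le_rfl
    have h2 : a * ((a * V f - b * V g - d) / (-a)) = -(a * V f - b * V g - d) := by
      rw [div_neg, mul_neg, mul_div_cancel₀ _ hneg.ne]
    rw [mul_add, h2] at h1
    linarith
  have hb : 0 ≤ b := by
    by_contra! hneg
    have h1 := hquad (V f) (V g - (a * V f - b * V g - d) / (-b)) le_rfl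
      (sub_le_self _ (div_nonneg (by linarith) (by linarith)))
    have h2 : b * ((a * V f - b * V g - d) / (-b)) = -(a * V f - b * V g - d) := by
      rw [div_neg, mul_neg, mul_div_cancel₀ _ hneg.ne]
    rw [mul_sub, h2] at h1
    linarith
  have hsep : ∀ s, a * (u (f s) - V f) + (d - c) ≤ b * (u (g s) - V g) := fun s => by
    have := hlc _ ⟨dirac 𝒜 s, trivial, rfl⟩
    rw [hF, hl, integral_dirac, integral_dirac] at this
    linarith
  rcases le_total a b with hab | hab
  · have hbpos : 0 < b := hb.lt_of_ne fun h0 => by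
      obtain ⟨s⟩ := ‹Nonempty S›
      have := hsep s
      rw [le_antisymm (hab.trans h0.ge) ha, ← h0] at this
      linarith
    obtain ⟨x, hx⟩ := h.exists_eq hu f
    set α : unitInterval := ⟨a / b, div_nonneg ha hb, (div_le_one hbpos).2 hab⟩
    have h1 := h.translate (mixAct hX α f (SimpleMap.const 𝒜 x)) g (V g - V f + (d - c) / b)
      fun s => by
        have h2 : u (mixAct hX α f (SimpleMap.const 𝒜 x) s) = a / b * u (f s) + (1 - a / b) * V f :=
          hx ▸ hu.2 α (f s) x
        have h3 := (div_le_iff₀' hbpos).2 (hsep s)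
        have h4 : (a * (u (f s) - V f) + (d - c)) / b =
          a / b * u (f s) - a / b * V f + (d - c) / b := by ring
        linarith
    rw [h.mix_of_unitInterval hu, hx] at h1
    linarith [div_pos (sub_pos.2 hcd) hbpos]
  · have hapos : 0 < a := ha.lt_of_ne fun h0 => by
      obtain ⟨s⟩ := ‹Nonempty S›
      have := hsep s
      rw [le_antisymm (hab.trans h0.ge) hb, ← h0] at this
      linarith
    obtain ⟨x, hx⟩ := h.exists_eq hu g
    set α : unitInterval := ⟨b / a, div_nonneg hb ha, (div_le_one hapos).2 hab⟩
    have h1 := h.translate f (mixAct hX α g (SimpleMap.const 𝒜 x)) (V g - V f + (d - c) / a)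
      fun s => by
        have h2 : u (mixAct hX α g (SimpleMap.const 𝒜 x) s) = b / a * u (g s) + (1 - b / a) * V g :=
          hx ▸ hu.2 α (g s) x
        have h3 := (le_div_iff₀' hapos).2 (le_sub_iff_add_le.2 (hsep s))
        have h4 : (b * (u (g s) - V g) - (d - c)) / a =
          b / a * u (g s) - b / a * V g - (d - c) / a := by ring
        linarith
    rw [h.mix_of_unitInterval hu, hx] at h1
    linarith [div_pos (sub_pos.2 hcd) hapos]

/-- The maximum at `f` is attained at the half-space of priors that value `f` at least as highly
as the preference does. -/
theorem Represents.isGreatest_maxMin [Nonempty S] (h : Represents hX R u V)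
    (hu : NonconstantAffine hX u) :
    IsGreatest {Ps | MaxMinRep R u Ps} (maximalMaxMinFamily R u) := by
  refine ⟨⟨fun P hP => hP.1, V, fun f => ⟨?_, ?_⟩, h.le_iff⟩, fun Ps hPs P hP => ?_⟩
  · set P : Set (FinAddProb 𝒜) := {p | V f ≤ p.integral (f.map u)} with hPdef
    have hP : IsPriorSet P := isPriorSet_le_integral _ _
      ((h.exists_prob hu f f).imp fun _ => And.left)
    have hle : ∀ g m, IsMin P (g.map u) m → m ≤ V g := fun g m hm => by
      obtain ⟨p, hp, hpg⟩ := h.exists_prob hu f g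
      exact (hm.2 ⟨p, hp, rfl⟩).trans hpg
    refine ⟨P, ⟨hP, fun g x hx => ?_⟩, ?_⟩
    · obtain ⟨m, hm⟩ := hP.exists_isMin (g.map u)
      exact ⟨m, hm, (h.certaintyEquivalent_iff.1 hx).symm ▸ hle g m hm⟩
    · obtain ⟨m, hm⟩ := hP.exists_isMin (f.map u)
      obtain ⟨p, hp, hpm⟩ := hm.1
      rwa [le_antisymm (hle f m hm) (hpm ▸ hp)] at hm
  · rintro m ⟨P, hP, hm⟩
    obtain ⟨x, hx⟩ := h.exists_eq hu f
    obtain ⟨m', hm', hle⟩ := hP.2 f x (h.certaintyEquivalent_iff.2 hx)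
    rw [hm.unique hm', ← hx]
    exact hle
  · obtain ⟨W, hW, hrep⟩ := MaxMinRep.exists_represents hu hPs
    refine ⟨hPs.1 P hP, fun f x hx => ?_⟩
    obtain ⟨m, hm⟩ := (hPs.1 P hP).exists_isMin (f.map u)
    exact ⟨m, hm, (hrep.certaintyEquivalent_iff.1 hx).symm ▸ (hW f).2 ⟨P, hP, hm⟩⟩

/-! ### Min-max representations and utility indices -/

theorem Represents.isGreatest_minMax [Nonempty S] (h : Represents hX R u V)
    (hu : NonconstantAffine hX u) :
    IsGreatest {Qs | MinMaxRep R u Qs} (maximalMinMaxFamily R u) := by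
  simp only [minMaxRep_iff, maximalMinMaxFamily_eq]
  exact h.dual.isGreatest_maxMin hu.neg

theorem MinMaxRep.exists_represents (hu : NonconstantAffine hX u)
    {Qs : Set (Set (FinAddProb 𝒜))} (h : MinMaxRep R u Qs) : ∃ V, Represents hX R u V := by
  obtain ⟨V, -, hV⟩ := MaxMinRep.exists_represents hu.neg ((minMaxRep_iff Qs).1 h)
  exact ⟨fun f => -V f, by simpa using hV.dual⟩

theorem isUtilityIndex_iff [Nonempty S] :
    IsUtilityIndex hX R u ↔ NonconstantAffine hX u ∧ ∃ V, Represents hX R u V := by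
  refine and_congr_right fun hu => ⟨?_, ?_⟩
  · rintro (⟨Ps, h⟩ | ⟨Qs, h⟩)
    · obtain ⟨V, -, hV⟩ := MaxMinRep.exists_represents hu h
      exact ⟨V, hV⟩
    · exact MinMaxRep.exists_represents hu h
  · rintro ⟨V, hV⟩
    exact Or.inl ⟨_, (hV.isGreatest_maxMin hu).1⟩

end Representation

theorem mainTheorem2 {S : Type*} [Nonempty S] (𝒜 : BooleanSubalgebra (Set S))
    {E : Type*} [AddCommGroup E] [Module ℝ E] (X : Set E) (hX : Convex ℝ X) (hne : X.Nonempty)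
    (R : Act 𝒜 X → Act 𝒜 X → Prop) :
    -- equivalence of the axioms and the two representations
    (InvariantBiseparable hX R ↔
      ∃ u : X → ℝ, NonconstantAffine hX u ∧ ∃ Ps, MaxMinRep R u Ps) ∧
    (InvariantBiseparable hX R ↔
      ∃ u : X → ℝ, NonconstantAffine hX u ∧ ∃ Qs, MinMaxRep R u Qs) ∧
    -- existence of certainty equivalents
    (InvariantBiseparable hX R → ∀ f : Act 𝒜 X, ∃ x : X, CertaintyEquivalent R f x) ∧
    -- cardinal uniqueness of the utility function
    (∀ u : X → ℝ, IsUtilityIndex hX R u → ∀ v : X → ℝ,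
      IsUtilityIndex hX R v ↔ ∃ a b : ℝ, 0 < a ∧ ∀ x, v x = a * u x + b) ∧
    -- the greatest families, with respect to inclusion
    (∀ u : X → ℝ, IsUtilityIndex hX R u →
      IsGreatest {Ps | MaxMinRep R u Ps} (maximalMaxMinFamily R u) ∧
      IsGreatest {Qs | MinMaxRep R u Qs} (maximalMinMaxFamily R u)) := by
  refine ⟨⟨fun h => ?_, ?_⟩, ⟨fun h => ?_, ?_⟩, fun h => h.exists_certaintyEquivalent,
    fun u hu v => ?_, fun u hu => ?_⟩
  · obtain ⟨u, hu, V, hV⟩ := h.exists_represents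
    exact ⟨u, hu, _, (hV.isGreatest_maxMin hu).1⟩
  · rintro ⟨u, hu, Ps, hPs⟩
    obtain ⟨V, -, hV⟩ := MaxMinRep.exists_represents hu hPs
    exact hV.invariantBiseparable hu
  · obtain ⟨u, hu, V, hV⟩ := h.exists_represents
    exact ⟨u, hu, _, (hV.isGreatest_minMax hu).1⟩
  · rintro ⟨u, hu, Qs, hQs⟩
    obtain ⟨V, hV⟩ := MinMaxRep.exists_represents hu hQs
    exact hV.invariantBiseparable hu
  · obtain ⟨hua, V, hV⟩ := isUtilityIndex_iff.1 hu
    rw [isUtilityIndex_iff]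
    constructor
    · rintro ⟨hva, W, hW⟩
      refine hua.eq_affine hva fun x y => ?_
      rw [← hV.const, ← hV.const, ← hW.const, ← hW.const, ← hV.le_iff, ← hW.le_iff]
    · rintro ⟨a, b, ha, hv⟩
      obtain rfl : v = fun x => a * u x + b := funext hv
      exact ⟨hua.affine ha b, _, hV.affine ha b⟩
  · obtain ⟨hua, V, hV⟩ := isUtilityIndex_iff.1 hu
    exact ⟨hV.isGreatest_maxMin hua, hV.isGreatest_minMax hua⟩
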